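/- **Theorem 2 (Approximation by the CNN-Sig model).** Let $T>0$ and $d\ge 1$. Let $\mathcal V^1([0,T],\mathbb R^d)$ be the space of continuous paths $x:[0,T]\to\mathbb R^d$ of finite $1$-variation $\|x\|_1$, with the norm $\|x\|_1+\|x\|_\infty$, and let $\mathcal V^1_D([0,T],\mathbb R^d)$ be the subset of piecewise linear paths, i.e. of those $x$ for which there are $0=t_0<\dots<t_n=T$ such that $x$ is the linear interpolation of $x(t_{i-1})$ and $x(t_i)$ on each $[t_{i-1},t_i]$. Let $c$ be a positive integer dividing $d$ and put $\gamma=d/c$. A *CNN layer* with $c$ kernels is given by a matrix $\kappa\in\mathbb R^{c\times c}$, whose rows are the kernels (window $1\times c$, stride $1\times c$). It maps $x\in\mathcal V^1([0,T],\mathbb R^d)$ to the $c$-tuple $\mathbf K(x)=(\mathbf K(x)_1,\dots,\mathbf K(x)_c)$ of paths in $\mathcal V^1([0,T],\mathbb R^{\gamma+1})$ given by $$\mathbf K(x)_i(t)=\bigl(t,\tilde x_i^1(t),\dots,\tilde x_i^\gamma(t)\bigr),\qquad \tilde x_i^l(t)=\sum_{j=1}^c\kappa_{ij}\,x^{(l-1)c+j}(t).$$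 For $X\in\mathcal V^1([0,T],\mathbb R^e)$ let $S^m(X)=(1,X^1,\dots,X^m)$ be the signature truncated at depth $m$, where $X^k=\int_{0<t_1<\dots<t_k<T}dX_{t_1}\otimes\dots\otimes dX_{t_k}\in(\mathbb R^e)^{\otimes k}$ is the iterated Stieltjes integral, and let $S^m\circ\mathbf K(x)=\bigl(S^m(\mathbf K(x)_1),\dots,S^m(\mathbf K(x)_c)\bigr)$, regarded as the vector of its coordinates. Fix a continuous activation function $\sigma:\mathbb R\to\mathbb R$ that is not a polynomial. Let $K\subset\mathcal V^1_D([0,T],\mathbb R^d)$ be compact and let $f:\mathcal V^1_D([0,T],\mathbb R^d)\to\mathbb R$ be Lipschitz on $K$. Suppose that $f(x)=f(y)$ whenever $x,y\in K$ differ by a constant vector (this holds automatically if all paths in $K$ have the same starting point). Then for every $\epsilon>0$ there exist a CNN layer $\mathbf K$ with $c$ kernels, an integer $m\ge0$, and a fully connected feedforward neural network $\Phi$ with activation function $\sigma$, with at least one hidden layer and with an affine real-valued output layer, such that $$\sup_{x\in K}\bigl|f(x)-\Phi\circ S^m\circ\mathbf K(x)\bigr|<\epsilon .$$ -/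

import Mathlib

open MeasureTheory

noncomputable section

/-! ### Paths of bounded variation -/

theorem eVariationOn_path_add_le {T : ℝ} {d : ℕ}
    (x y : Set.Icc (0 : ℝ) T → EuclideanSpace ℝ (Fin d)) :
    eVariationOn (fun t => x t + y t) Set.univ ≤
      eVariationOn x Set.univ + eVariationOn y Set.univ := by
  refine iSup_le fun p => ?_
  calc ∑ i ∈ Finset.range p.1, edist (x (p.2.1 (i + 1)) + y (p.2.1 (i + 1)))
          (x (p.2.1 i) + y (p.2.1 i))
      ≤ ∑ i ∈ Finset.range p.1, (edist (x (p.2.1 (i + 1))) (x (p.2.1 i)) +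
          edist (y (p.2.1 (i + 1))) (y (p.2.1 i))) :=
        Finset.sum_le_sum fun i _ => edist_add_add_le _ _ _ _
    _ ≤ _ := by
        rw [Finset.sum_add_distrib]
        exact add_le_add (eVariationOn.sum_le p.2.2.1 fun i => Set.mem_univ _)
          (eVariationOn.sum_le p.2.2.1 fun i => Set.mem_univ _)

/-- Continuous paths `[0,T] → ℝ^d` (Euclidean norm) of finite `1`-variation, as a linear subspace of
the continuous functions. -/
def bvSubmodule (T : ℝ) (d : ℕ) :
    Submodule ℝ C(Set.Icc (0 : ℝ) T, EuclideanSpace ℝ (Fin d)) where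
  carrier := {x | BoundedVariationOn x Set.univ}
  zero_mem' := by
    have h : eVariationOn (fun _ : Set.Icc (0 : ℝ) T => (0 : EuclideanSpace ℝ (Fin d)))
        Set.univ = 0 := by
      refine eVariationOn.constant_on ?_
      rintro _ ⟨_, _, rfl⟩ _ ⟨_, _, rfl⟩
      rfl
    change eVariationOn (fun _ : Set.Icc (0 : ℝ) T => (0 : EuclideanSpace ℝ (Fin d)))
      Set.univ ≠ ⊤
    rw [h]; exact ENNReal.zero_ne_top
  add_mem' := by
    intro x y hx hy
    exact ne_top_of_le_ne_top (ENNReal.add_ne_top.2 ⟨hx, hy⟩) (eVariationOn_path_add_le x y)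
  smul_mem' := by
    intro c x hx
    exact (lipschitzWith_smul c).comp_boundedVariationOn hx

/-- The space `𝒱¹([0,T], ℝ^d)` of continuous paths of finite `1`-variation. -/
def BVPath (T : ℝ) (d : ℕ) : Type := bvSubmodule T d

namespace BVPath

variable {T : ℝ} {d : ℕ}

instance : AddCommGroup (BVPath T d) := inferInstanceAs (AddCommGroup (bvSubmodule T d))

instance : Module ℝ (BVPath T d) := inferInstanceAs (Module ℝ (bvSubmodule T d))

/-- The underlying continuous function. -/
def toCont (x : BVPath T d) : C(Set.Icc (0 : ℝ) T, EuclideanSpace ℝ (Fin d)) := x.1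

instance : CoeFun (BVPath T d) fun _ => Set.Icc (0 : ℝ) T → EuclideanSpace ℝ (Fin d) :=
  ⟨fun x => x.toCont⟩

theorem bv (x : BVPath T d) : BoundedVariationOn x Set.univ := x.2

/-- The `1`-variation of a path. -/
def oneVar (x : BVPath T d) : ℝ := (eVariationOn x Set.univ).toReal

/-- `‖x‖ = ‖x‖_1 + ‖x‖_∞`, the sum of the `1`-variation and of the supremum norm. -/
def pathNorm : AddGroupNorm (BVPath T d) where
  toFun x := x.oneVar + ‖x.toCont‖
  map_zero' := by
    have h : eVariationOn (fun _ : Set.Icc (0 : ℝ) T => (0 : EuclideanSpace ℝ (Fin d)))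
        Set.univ = 0 := by
      refine eVariationOn.constant_on ?_
      rintro _ ⟨_, _, rfl⟩ _ ⟨_, _, rfl⟩
      rfl
    have h1 : oneVar (0 : BVPath T d) = 0 := by
      change (eVariationOn (fun _ : Set.Icc (0 : ℝ) T => (0 : EuclideanSpace ℝ (Fin d)))
        Set.univ).toReal = 0
      rw [h]; rfl
    have h2 : ‖toCont (0 : BVPath T d)‖ = 0 := norm_zero
    rw [h1, h2, add_zero]
  add_le' x y := by
    have h1 : oneVar (x + y) ≤ oneVar x + oneVar y := by
      unfold oneVar
      rw [← ENNReal.toReal_add x.bv y.bv]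
      exact ENNReal.toReal_mono (ENNReal.add_ne_top.2 ⟨x.bv, y.bv⟩) (eVariationOn_path_add_le x y)
    have h2 : ‖toCont (x + y)‖ ≤ ‖toCont x‖ + ‖toCont y‖ := norm_add_le x.toCont y.toCont
    linarith
  neg' x := by
    have h1 : oneVar (-x) = oneVar x := by
      unfold oneVar eVariationOn
      congr 1
      refine iSup_congr fun p => Finset.sum_congr rfl fun i _ => ?_
      exact edist_neg_neg (x (p.2.1 (i + 1))) (x (p.2.1 i))
    have h2 : ‖toCont (-x)‖ = ‖toCont x‖ := norm_neg x.toCont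
    rw [h1, h2]
  eq_zero_of_map_eq_zero' x h := by
    have h1 : 0 ≤ oneVar x := ENNReal.toReal_nonneg
    have h2 : 0 ≤ ‖toCont x‖ := norm_nonneg _
    have h3 : ‖toCont x‖ = 0 := by
      change oneVar x + ‖toCont x‖ = 0 at h
      linarith
    exact Subtype.ext (norm_eq_zero.1 h3)

instance : NormedAddCommGroup (BVPath T d) := pathNorm.toNormedAddCommGroup

end BVPath

/-- `x` is the linear interpolation of its values at finitely many times
`0 = t_0 < ⋯ < t_n = T`. -/
def IsPiecewiseLinear {T : ℝ} {d : ℕ} (x : BVPath T d) : Prop :=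
  ∃ (n : ℕ) (t : Fin (n + 1) → Set.Icc (0 : ℝ) T), StrictMono t ∧
    (t 0 : ℝ) = 0 ∧ (t (Fin.last n) : ℝ) = T ∧
    ∀ (i : Fin n) (s : Set.Icc (0 : ℝ) T), t i.castSucc ≤ s → s ≤ t i.succ →
      x s = (((t i.succ : ℝ) - s) / ((t i.succ : ℝ) - t i.castSucc)) • x (t i.castSucc) +
        (((s : ℝ) - t i.castSucc) / ((t i.succ : ℝ) - t i.castSucc)) • x (t i.succ)

/-- The space `𝒱¹_D([0,T], ℝ^d)` of piecewise linear paths, with the metric of `𝒱¹([0,T], ℝ^d)`. -/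
abbrev PLPath (T : ℝ) (d : ℕ) : Type := {x : BVPath T d // IsPiecewiseLinear x}

/-! ### The signature -/

instance {T : ℝ} : CompactIccSpace (Set.Icc (0 : ℝ) T) :=
  ⟨fun {_ _} => isClosed_Icc.isCompact⟩

/-- The coordinates of a path of bounded variation are of bounded variation. -/
theorem BVPath.bv_coord {T : ℝ} {d : ℕ} (x : BVPath T d) (i : Fin d) :
    BoundedVariationOn (fun t => x t i) Set.univ :=
  (EuclideanSpace.proj (𝕜 := ℝ) i).lipschitz.comp_boundedVariationOn x.bv

/-- The signed Lebesgue–Stieltjes measure `dXⁱ` on `[0,T]` of the `i`-th coordinate of a path. -/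
def BVPath.stieltjes {T : ℝ} {d : ℕ} (x : BVPath T d) (i : Fin d) :
    SignedMeasure (Set.Icc (0 : ℝ) T) :=
  (x.bv_coord i).vectorMeasure

/-- The iterated Stieltjes integral `∫_{0<t_1<⋯<t_k<t} dX^{w_1}_{t_1} ⋯ dX^{w_k}_{t_k}` of the word
`w = w_1 ⋯ w_k`, as a function of `t`. The measures have no atoms, because the path is
continuous. -/
def BVPath.iterInt {T : ℝ} {d : ℕ} (x : BVPath T d) :
    (k : ℕ) → (Fin k → Fin d) → Set.Icc (0 : ℝ) T → ℝ
  | 0, _, _ => 1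
  | k + 1, w, t =>
      ∫ᵛ s in Set.Iic t, BVPath.iterInt x k (Fin.init w) s ∂•(x.stieltjes (w (Fin.last k)))

/-- Words of length at most `m` in the letters `0, …, d - 1`. -/
abbrev TruncWord (d m : ℕ) : Type := Σ k : Fin (m + 1), (Fin k → Fin d)

/-- The truncated signature `S^m(X) = (1, X¹, …, X^m) ∈ T^m(ℝ^d)`, given by its coordinates in the
basis `e_{w_1} ⊗ ⋯ ⊗ e_{w_k}`, `k ≤ m`, of the truncated tensor algebra. -/
def BVPath.truncSig {T : ℝ} {d : ℕ} (hT : 0 ≤ T) (m : ℕ) (x : BVPath T d) : TruncWord d m → ℝ :=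
  fun w => x.iterInt w.1 w.2 ⟨T, hT, le_rfl⟩

/-! ### The convolutional layer -/

/-- The position of the `j`-th entry of the `l`-th block, when `d` channels are divided into `d / c`
consecutive blocks of `c` channels. -/
def blockIndex {d c : ℕ} (l : Fin (d / c)) (j : Fin c) : Fin d :=
  ⟨l * c + j, by
    calc (l : ℕ) * c + j < l * c + c := Nat.add_lt_add_left j.2 _
      _ = (l + 1) * c := by ring
      _ ≤ d / c * c := Nat.mul_le_mul_right _ l.2
      _ ≤ d := Nat.div_mul_le_self d c⟩

/-- The function `t ↦ (t, x̃_i(t))`, where `x̃_i^l(t) = ∑_j κ i j * x^{l c + j}(t)` for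
`0 ≤ l < d / c`. -/
def cnnFun {T : ℝ} {d c : ℕ} (κ : Matrix (Fin c) (Fin c) ℝ) (x : BVPath T d) (i : Fin c)
    (t : Set.Icc (0 : ℝ) T) : EuclideanSpace ℝ (Fin (d / c + 1)) :=
  WithLp.toLp 2 (Fin.cons (t : ℝ) fun l : Fin (d / c) =>
    ∑ j : Fin c, κ i j * x t (blockIndex l j))

theorem cnnFun_continuous {T : ℝ} {d c : ℕ} (κ : Matrix (Fin c) (Fin c) ℝ) (x : BVPath T d)
    (i : Fin c) : Continuous (cnnFun κ x i) := by
  have hx : Continuous fun t => x t := x.toCont.continuous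
  refine (PiLp.continuous_toLp 2 _).comp (continuous_pi fun l => ?_)
  refine Fin.cases ?_ (fun l => ?_) l
  · simpa using continuous_subtype_val
  · simp only [Fin.cons_succ]
    fun_prop

theorem cnnFun_bv {T : ℝ} {d c : ℕ} (κ : Matrix (Fin c) (Fin c) ℝ) (x : BVPath T d)
    (i : Fin c) : BoundedVariationOn (cnnFun κ x i) Set.univ := by
  have hcoord (l : Fin (d / c + 1)) : BoundedVariationOn (fun t => cnnFun κ x i t l) Set.univ := by
    refine Fin.cases ?_ (fun l => ?_) l
    · refine MonotoneOn.boundedVariationOn (C := T) (fun a _ b _ hab => ?_) (fun t _ => ?_)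
      · simpa [cnnFun] using hab
      · simpa [cnnFun, abs_of_nonneg t.2.1] using t.2.2
    · let L : EuclideanSpace ℝ (Fin d) →L[ℝ] ℝ :=
        ∑ j : Fin c, κ i j • EuclideanSpace.proj (𝕜 := ℝ) (blockIndex l j)
      have h := L.lipschitz.comp_boundedVariationOn x.bv
      have e : (fun t => cnnFun κ x i t l.succ) = L ∘ x := by
        funext t
        simp [cnnFun, L]
      rw [e]
      exact h
  refine ne_top_of_le_ne_top ((ENNReal.sum_ne_top (s := Finset.univ)).2 fun l _ => hcoord l) (iSup_le fun p => ?_)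
  calc ∑ n ∈ Finset.range p.1, edist (cnnFun κ x i (p.2.1 (n + 1))) (cnnFun κ x i (p.2.1 n))
      ≤ ∑ n ∈ Finset.range p.1, ∑ l, edist (cnnFun κ x i (p.2.1 (n + 1)) l)
          (cnnFun κ x i (p.2.1 n) l) := by
        refine Finset.sum_le_sum fun n _ => ?_
        rw [edist_eq_enorm_sub]
        set v := cnnFun κ x i (p.2.1 (n + 1)) - cnnFun κ x i (p.2.1 n) with hv
        have h1 : v = ∑ l, EuclideanSpace.single l (v l) := by
          ext k
          simp [Pi.single_apply]
        calc ‖v‖ₑ = ‖∑ l, EuclideanSpace.single l (v l)‖ₑ := by rw [← h1]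
          _ ≤ ∑ l, ‖EuclideanSpace.single l (v l)‖ₑ := enorm_sum_le _ _
          _ = _ := by
            refine Finset.sum_congr rfl fun l _ => ?_
            rw [edist_eq_enorm_sub, ← ofReal_norm, ← ofReal_norm, PiLp.norm_single]
            rfl
    _ = ∑ l, ∑ n ∈ Finset.range p.1, edist (cnnFun κ x i (p.2.1 (n + 1)) l)
          (cnnFun κ x i (p.2.1 n) l) := Finset.sum_comm
    _ ≤ _ := Finset.sum_le_sum fun l _ =>
        eVariationOn.sum_le (f := fun t => cnnFun κ x i t l) p.2.2.1 fun n => Set.mem_univ _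

/-- The convolutional layer with `c` kernels, the rows of `κ`, of window size `1 × c` and stride
`1 × c`, with a time channel added to each of its `c` output paths. -/
def cnnLayer {T : ℝ} {d c : ℕ} (κ : Matrix (Fin c) (Fin c) ℝ) (x : BVPath T d) (i : Fin c) :
    BVPath T (d / c + 1) :=
  ⟨⟨cnnFun κ x i, cnnFun_continuous κ x i⟩, cnnFun_bv κ x i⟩

/-! ### Neural networks -/

/-- The functions computed by the successive hidden layers of fully connected feedforward networks
with activation function `σ`: each layer applies an affine map and then `σ` in each coordinate. -/
inductive IsHiddenLayer (σ : ℝ → ℝ) {ι : Type} [Fintype ι] :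
    {n : ℕ} → ((ι → ℝ) → Fin n → ℝ) → Prop
  | first {n : ℕ} (W : Matrix (Fin n) ι ℝ) (b : Fin n → ℝ) :
      IsHiddenLayer σ fun z i => σ (W.mulVec z i + b i)
  | next {k n : ℕ} {F : (ι → ℝ) → Fin k → ℝ} (hF : IsHiddenLayer σ F)
      (W : Matrix (Fin n) (Fin k) ℝ) (b : Fin n → ℝ) :
      IsHiddenLayer σ fun z i => σ (W.mulVec (F z) i + b i)

/-- `Φ` is computed by a fully connected feedforward neural network with activation function `σ`, at
least one hidden layer and an affine output layer. -/
def IsNeuralNetwork (σ : ℝ → ℝ) {ι : Type} [Fintype ι] (Φ : (ι → ℝ) → ℝ) : Prop :=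
  ∃ (n : ℕ) (F : (ι → ℝ) → Fin n → ℝ) (a : Fin n → ℝ) (b : ℝ), IsHiddenLayer σ F ∧
    ∀ z, Φ z = ∑ i, a i * F z i + b

/-- The features `S^m ∘ 𝐊 (x)`: the concatenation of the truncated signatures of the `c` output
paths of the convolutional layer. -/
def cnnSig {T : ℝ} {d c : ℕ} (hT : 0 ≤ T) (m : ℕ) (κ : Matrix (Fin c) (Fin c) ℝ)
    (x : BVPath T d) : Fin c × TruncWord (d / c + 1) m → ℝ :=
  fun p => (cnnLayer κ x p.1).truncSig hT m p.2

end

/-! The identity matrix suffices as the kernel matrix: it only distributes the channels of `x` among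
the output paths, each of which also carries time. In the signature of an output path, the word `0 ⋯
0 l` with `k` letters `0` is the Stieltjes integral of `s ^ k / k!` against channel `l`. Integration
by parts (`iterInt_snoc_time`) turns it into an expression in the increment from time `0`: `k = 0`
gives the final increment, and the higher `k` then give its moments. By Weierstrass these determine
the increment (`increment_eq_of_iterInt_eq`), so paths with equal features differ by a constant, and
`f` agrees on them. The same formula makes the features continuous.

It remains to approximate a continuous function factoring through continuous features on a compact
space (`exists_network_approx`). The closed span of the functions `σ (w * h + b)` contains the same
functions for mollified `σ`; differentiating in `w` at `w = 0` produces the powers of `h`, because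
no derivative of every mollification can vanish identically unless `σ` is a polynomial. Hence the
closed span contains `exp h`. Exponentials of a linear space of functions are closed under products,
so Stone–Weierstrass applies. An approximant uses finitely many features, hence a finite depth. -/

open MeasureTheory

noncomputable section

/-! ### Mollifications of a non-polynomial function -/

section Polynomials

open Polynomial Filter Topology

/-- A pointwise limit of polynomials of bounded degree is a polynomial. -/
theorem exists_polynomial_of_tendsto {k : ℕ} {c : ℕ → ℕ → ℝ} {f : ℝ → ℝ}
    (hf : ∀ t, Tendsto (fun n => ∑ i ∈ Finset.range k, c n i * t ^ i) atTop (𝓝 (f t))) :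
    ∃ q : ℝ[X], ∀ t, f t = q.eval t := by
  let p (n : ℕ) : ℝ[X] := ∑ i ∈ Finset.range k, C (c n i) * X ^ i
  have hp (n : ℕ) : (p n).degree < k := by
    simp only [p, Finset.sum_range]
    exact degree_sum_fin_lt _
  replace hf (t : ℝ) : Tendsto (fun n => (p n).eval t) atTop (𝓝 (f t)) := by
    simpa [p, eval_finsetSum] using hf t
  have hinj : Set.InjOn (fun i : ℕ => (i : ℝ)) (Finset.range k : Finset ℕ) :=
    fun a _ b _ h => by simpa using h
  -- Each `p n` is its own interpolant at `0, …, k - 1`, and interpolation depends continuously on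
  -- the values at these nodes.
  refine ⟨Lagrange.interpolate (Finset.range k) (fun i : ℕ => (i : ℝ)) fun i => f i, fun t => ?_⟩
  refine tendsto_nhds_unique (hf t) ?_
  have h (n : ℕ) : (p n).eval t =
      ∑ i ∈ Finset.range k, (p n).eval (i : ℝ) *
        (Lagrange.basis (Finset.range k) (fun i : ℕ => (i : ℝ)) i).eval t := by
    conv_lhs => rw [Lagrange.eq_interpolate (f := p n) hinj (by simpa using hp n)]
    simp [Lagrange.interpolate_apply, eval_finsetSum]
  simp_rw [h]
  rw [Lagrange.interpolate_apply, eval_finsetSum]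
  simp only [eval_mul, eval_C]
  exact tendsto_finsetSum _ fun i _ => (hf i).mul_const _

/-- A smooth function whose `k`-th derivative vanishes is a polynomial of degree less than `k`. -/
theorem exists_sum_pow_of_iteratedDeriv_eq_zero (k : ℕ) :
    ∀ g : ℝ → ℝ, ContDiff ℝ k g → (∀ t, iteratedDeriv k g t = 0) →
      ∃ c : ℕ → ℝ, ∀ t, g t = ∑ i ∈ Finset.range k, c i * t ^ i := by
  induction k with
  | zero => exact fun g _ h => ⟨0, by simpa using h⟩
  | succ k ih =>
    intro g hg h
    have hg1 : Differentiable ℝ g := hg.differentiable (by simp)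
    have hg2 : ContDiff ℝ k (deriv g) :=
      ((contDiff_succ_iff_deriv (n := k) (𝕜 := ℝ)).1 (by exact_mod_cast hg)).2.2
    obtain ⟨c, hc⟩ := ih (deriv g) hg2 fun t => by rw [← iteratedDeriv_succ', h t]
    -- The antiderivative of the polynomial `deriv g`, with constant term `g 0`.
    refine ⟨fun i => i.casesOn (g 0) fun j => c j / (j + 1), fun t => ?_⟩
    have hq (t : ℝ) : HasDerivAt (fun t => ∑ i ∈ Finset.range k, c i / (i + 1) * t ^ (i + 1))
        (∑ i ∈ Finset.range k, c i * t ^ i) t := by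
      refine HasDerivAt.fun_sum fun i _ => ?_
      refine ((hasDerivAt_pow (i + 1) t).const_mul (c i / (i + 1))).congr_deriv ?_
      have : (i : ℝ) + 1 ≠ 0 := by positivity
      push_cast
      field_simp
    have hd (t : ℝ) : HasDerivAt
        (fun t => g t - ∑ i ∈ Finset.range k, c i / (i + 1) * t ^ (i + 1)) 0 t := by
      refine ((hg1 t).hasDerivAt.sub (hq t)).congr_deriv ?_
      rw [hc, sub_self]
    have := is_const_of_deriv_eq_zero (fun t => (hd t).differentiableAt) (fun t => (hd t).deriv) t 0
    rw [Finset.sum_range_succ']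
    simp at this ⊢
    linarith

/-- Some mollification of a continuous function that is not a polynomial has a `k`-th derivative
that does not vanish identically. -/
theorem exists_iteratedDeriv_convolution_ne_zero {σ : ℝ → ℝ} (hσ : Continuous σ)
    (hσp : ¬ ∃ p : ℝ[X], ∀ t, σ t = p.eval t) (k : ℕ) :
    ∃ ψ : ContDiffBump (0 : ℝ), ∃ b,
      iteratedDeriv k (convolution (ψ.normed volume) σ (.lsmul ℝ ℝ) volume) b ≠ 0 := by
  by_contra! H
  refine hσp ?_
  -- Bumps of shrinking support: the mollifications are polynomials of degree less than `k` and
  -- converge pointwise to `σ`.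
  let ψ (n : ℕ) : ContDiffBump (0 : ℝ) :=
    ⟨1 / (n + 1) / 2, 1 / (n + 1), by positivity, half_lt_self (by positivity)⟩
  have hs (n : ℕ) : ContDiff ℝ k
      (convolution ((ψ n).normed volume) σ (.lsmul ℝ ℝ) volume) :=
    (ψ n).hasCompactSupport_normed.contDiff_convolution_left _ (n := k)
      (ψ n).contDiff_normed hσ.locallyIntegrable
  choose c hc using fun n => exists_sum_pow_of_iteratedDeriv_eq_zero k _ (hs n) (H (ψ n))
  refine exists_polynomial_of_tendsto (k := k) (c := c) (f := σ) fun t => ?_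
  simp_rw [← hc]
  exact ContDiffBump.convolution_tendsto_right_of_continuous
    tendsto_one_div_add_atTop_nhds_zero_nat hσ t

end Polynomials

/-! ### Universal approximation on compact spaces -/

section Ridge

variable {X : Type*} [TopologicalSpace X]

/-- The function `x ↦ σ (w * h x + b)`. -/
def ridge (σ : C(ℝ, ℝ)) (h : C(X, ℝ)) (w b : ℝ) : C(X, ℝ) :=
  σ.comp (w • h + ContinuousMap.const X b)

@[simp]
theorem ridge_apply (σ : C(ℝ, ℝ)) (h : C(X, ℝ)) (w b : ℝ) (x : X) :
    ridge σ h w b x = σ (w * h x + b) := rfl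

theorem continuous_ridge (σ : C(ℝ, ℝ)) (h : C(X, ℝ)) {w b : ℝ → ℝ} (hw : Continuous w)
    (hb : Continuous b) : Continuous fun s => ridge σ h (w s) (b s) := by
  refine ContinuousMap.continuous_of_continuous_uncurry _ ?_
  change Continuous fun p : ℝ × X => σ (w p.1 * h p.2 + b p.1)
  fun_prop

/-- Closed subspaces contain integrals of functions with values in them. -/
theorem Submodule.integral_mem {E α : Type*} [NormedAddCommGroup E] [NormedSpace ℝ E]
    [CompleteSpace E] [MeasurableSpace α] {μ : Measure α} (V : Submodule ℝ E)
    (hV : IsClosed (V : Set E)) {F : α → E} (hF : ∀ a, F a ∈ V) (hi : Integrable F μ) :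
    ∫ a, F a ∂μ ∈ V := by
  by_contra hn
  obtain ⟨L, u, hL, hL'⟩ := geometric_hahn_banach_closed_point V.convex hV hn
  have hz (v) (hv : v ∈ V) : L v = 0 := by
    by_contra h0
    -- A functional bounded above by `u` on a subspace vanishes there: otherwise scaling `v` attains
    -- the value `u`.
    have := hL _ (V.smul_mem (u / L v) hv)
    rw [map_smul, smul_eq_mul, div_mul_cancel₀ _ h0] at this
    exact this.false
  have h0 : L (∫ a, F a ∂μ) = 0 := by
    rw [← L.integral_comp_comm hi]
    simp [hz _ (hF _)]
  have := hL 0 V.zero_mem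
  rw [map_zero] at this
  linarith

variable [CompactSpace X]

/-- A closed subspace containing all `x ↦ σ (w * h x + b)` contains the corresponding functions for
mollifications of `σ`. -/
theorem ridge_convolution_mem {V : Submodule ℝ C(X, ℝ)} (hV : IsClosed (V : Set C(X, ℝ)))
    {σ : C(ℝ, ℝ)} {h : C(X, ℝ)} (hσ : ∀ w b, ridge σ h w b ∈ V) (ψ : ContDiffBump (0 : ℝ))
    (g : C(ℝ, ℝ)) (hg : ⇑g = convolution (ψ.normed volume) σ (.lsmul ℝ ℝ) volume) (w b : ℝ) :
    ridge g h w b ∈ V := by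
  have hc : Continuous fun s => ψ.normed volume s • ridge σ h w (b - s) :=
    ψ.continuous_normed.smul (continuous_ridge σ h continuous_const (by fun_prop))
  have hi : Integrable fun s => ψ.normed volume s • ridge σ h w (b - s) :=
    hc.integrable_of_hasCompactSupport ψ.hasCompactSupport_normed.smul_right
  -- The convolution, read as a vector-valued integral in `C(X, ℝ)`.
  have : ridge g h w b = ∫ s, ψ.normed volume s • ridge σ h w (b - s) := by
    ext x
    have := (ContinuousMap.evalCLM ℝ x).integral_comp_comm hi
    simp only [ContinuousMap.evalCLM_apply] at this
    rw [← this, ridge_apply, hg, convolution_def]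
    simp [add_sub_assoc]
  rw [this]
  exact V.integral_mem hV (fun s => V.smul_mem _ (hσ _ _)) hi

/-- Differentiating `x ↦ P x * g (w * h x + b)` in `w`. -/
theorem hasDerivAt_mul_ridge (P h : C(X, ℝ)) {g g' : C(ℝ, ℝ)} (hg : ∀ t, HasDerivAt g (g' t) t)
    (w b : ℝ) : HasDerivAt (fun s => P * ridge g h s b) (P * h * ridge g' h w b) w := by
  have hc : Continuous fun s => P * h * ridge g' h s b :=
    continuous_const.mul (continuous_ridge g' h continuous_id continuous_const)
  -- The derivative is needed in the supremum norm. The pointwise fundamental theorem of calculus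
  -- gives an identity of `C(X, ℝ)`-valued integrals, which can then be differentiated in norm.
  have h1 (s : ℝ) : P * ridge g h s b =
      P * ridge g h 0 b + ∫ r in (0 : ℝ)..s, P * h * ridge g' h r b := by
    ext x
    have h2 := (ContinuousMap.evalCLM ℝ x).intervalIntegral_comp_comm
      (hc.intervalIntegrable (μ := volume) 0 s)
    simp only [ContinuousMap.evalCLM_apply] at h2
    rw [ContinuousMap.add_apply, ← h2]
    have h3 := intervalIntegral.integral_eq_sub_of_hasDerivAt (a := 0) (b := s)
      (f := fun r => P x * g (r * h x + b)) (f' := fun r => P x * h x * g' (r * h x + b))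
      (fun r _ => by
        have := ((hg (r * h x + b)).comp r (((hasDerivAt_id r).mul_const (h x)).add_const b)).const_mul
          (P x)
        refine this.congr_deriv ?_
        ring)
      ((by fun_prop : Continuous fun r => P x * h x * g' (r * h x + b)).intervalIntegrable _ _)
    simp only [ContinuousMap.mul_apply, ridge_apply]
    rw [h3]
    ring
  rw [funext h1]
  exact (intervalIntegral.integral_hasDerivAt_right (hc.intervalIntegrable 0 w)
    (hc.stronglyMeasurableAtFilter _ _) hc.continuousAt).const_add _

theorem Submodule.hasDerivAt_mem {E : Type*} [NormedAddCommGroup E] [NormedSpace ℝ E]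
    (V : Submodule ℝ E) (hV : IsClosed (V : Set E)) {γ : ℝ → E} (hγ : ∀ s, γ s ∈ V) {γ' : E} {w : ℝ}
    (h : HasDerivAt γ γ' w) : γ' ∈ V :=
  hV.mem_of_tendsto h.tendsto_slope (Filter.Eventually.of_forall fun s =>
    V.smul_mem _ (V.sub_mem (hγ s) (hγ w)))

/-- Each derivative in `w` brings down a factor `h` and replaces `g k` by its derivative; closedness
keeps the result in `V`. -/
theorem pow_mul_ridge_mem {V : Submodule ℝ C(X, ℝ)} (hV : IsClosed (V : Set C(X, ℝ)))
    {h : C(X, ℝ)} (g : ℕ → C(ℝ, ℝ)) (hg : ∀ k t, HasDerivAt (g k) (g (k + 1) t) t)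
    (h0 : ∀ w b, ridge (g 0) h w b ∈ V) (k : ℕ) (w b : ℝ) : h ^ k * ridge (g k) h w b ∈ V := by
  induction k generalizing w b with
  | zero => simpa using h0 w b
  | succ k ih =>
    rw [pow_succ]
    exact V.hasDerivAt_mem hV (fun s => ih s b) (hasDerivAt_mul_ridge (h ^ k) h (hg k) w b)

/-- A closed subspace of `C(X, ℝ)` containing all `x ↦ σ (w * h x + b)`, where `σ` is not a
polynomial, contains the powers of `h`. -/
theorem pow_mem_of_ridge_mem {V : Submodule ℝ C(X, ℝ)} (hV : IsClosed (V : Set C(X, ℝ)))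
    {σ : C(ℝ, ℝ)} (hσp : ¬ ∃ p : Polynomial ℝ, ∀ t, σ t = p.eval t) {h : C(X, ℝ)}
    (hσ : ∀ w b, ridge σ h w b ∈ V) (k : ℕ) : h ^ k ∈ V := by
  obtain ⟨ψ, b, hb⟩ := exists_iteratedDeriv_convolution_ne_zero σ.continuous hσp k
  set G := convolution (ψ.normed volume) σ (.lsmul ℝ ℝ) volume with hG
  have hs (n : ℕ) : ContDiff ℝ n G :=
    ψ.hasCompactSupport_normed.contDiff_convolution_left _ (n := n)
      ψ.contDiff_normed σ.continuous.locallyIntegrable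
  let g (n : ℕ) : C(ℝ, ℝ) := ⟨iteratedDeriv n G, (hs n).continuous_iteratedDeriv' n⟩
  have hg (n : ℕ) (t : ℝ) : HasDerivAt (g n) (g (n + 1) t) t := by
    have h1 : Differentiable ℝ (iteratedDeriv n G) :=
      (hs (n + 1)).differentiable_iteratedDeriv n (by exact_mod_cast n.lt_succ_self)
    have := (h1 t).hasDerivAt
    rwa [← iteratedDeriv_succ] at this
  have h1 := pow_mul_ridge_mem hV g hg
    (ridge_convolution_mem hV hσ ψ (g 0) (by simp [g, hG])) k 0 b
  -- At `w = 0` the ridge function is the nonzero constant `iteratedDeriv k G b`.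
  have h2 : h ^ k = (iteratedDeriv k G b)⁻¹ • (h ^ k * ridge (g k) h 0 b) := by
    ext x
    simp [g]
    field_simp
  rw [h2]
  exact V.smul_mem _ h1

/-- If a closed subspace of `C(X, ℝ)` contains the powers of `h`, it contains `exp h`. -/
theorem exp_mem_of_pow_mem {V : Submodule ℝ C(X, ℝ)} (hV : IsClosed (V : Set C(X, ℝ)))
    {h : C(X, ℝ)} (hh : ∀ k, h ^ k ∈ V) : NormedSpace.exp h ∈ V :=
  hV.mem_of_tendsto (NormedSpace.exp_series_hasSum_exp' (𝕂 := ℝ) h)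
    (Filter.Eventually.of_forall fun _ => V.sum_mem fun k _ => V.smul_mem _ (hh k))

theorem ContinuousMap.exp_apply' (h : C(X, ℝ)) (x : X) :
    NormedSpace.exp h x = Real.exp (h x) := by
  rw [Real.exp_eq_exp_ℝ]
  exact NormedSpace.map_exp (ContinuousMap.evalAlgHom ℝ ℝ x)
    (ContinuousMap.evalCLM ℝ x).continuous h

/-- **Universal approximation**: if `σ` is not a polynomial and `A` is a point-separating space of
functions containing the constants, the functions `σ ∘ h`, `h ∈ A`, span a dense subspace. -/
theorem topologicalClosure_span_comp_eq_top {σ : C(ℝ, ℝ)}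
    (hσp : ¬ ∃ p : Polynomial ℝ, ∀ t, σ t = p.eval t) (A : Submodule ℝ C(X, ℝ)) (h1 : 1 ∈ A)
    (hA : ∀ x y, x ≠ y → ∃ h ∈ A, h x ≠ h y) :
    (Submodule.span ℝ ((fun h : C(X, ℝ) => σ.comp h) '' A)).topologicalClosure = ⊤ := by
  set V := (Submodule.span ℝ ((fun h : C(X, ℝ) => σ.comp h) '' A)).topologicalClosure
  have hV : IsClosed (V : Set C(X, ℝ)) := Submodule.isClosed_topologicalClosure _
  have hexp (h : C(X, ℝ)) (hh : h ∈ A) : NormedSpace.exp h ∈ V := by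
    refine exp_mem_of_pow_mem hV (pow_mem_of_ridge_mem hV hσp fun w b => ?_)
    refine Submodule.le_topologicalClosure _ (Submodule.subset_span ⟨_, ?_, rfl⟩)
    have : ContinuousMap.const X b = b • (1 : C(X, ℝ)) := by ext; simp
    rw [this]
    exact A.add_mem (A.smul_mem _ hh) (A.smul_mem _ h1)
  -- Since `exp` turns sums into products, the algebra generated by `exp '' A` is merely its linear
  -- span.
  let M : Submonoid C(X, ℝ) :=
    { carrier := NormedSpace.exp '' (A : Set C(X, ℝ))
      one_mem' := ⟨0, A.zero_mem, NormedSpace.exp_zero⟩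
      mul_mem' := by
        rintro _ _ ⟨a, ha, rfl⟩ ⟨b, hb, rfl⟩
        exact ⟨a + b, A.add_mem ha hb, NormedSpace.exp_add⟩ }
  let B : Subalgebra ℝ C(X, ℝ) := Algebra.adjoin ℝ (M : Set C(X, ℝ))
  have hBV : (B : Set C(X, ℝ)) ⊆ V := by
    have : Subalgebra.toSubmodule B ≤ V := by
      rw [Algebra.adjoin_eq_span, Submonoid.closure_eq, Submodule.span_le]
      rintro _ ⟨h, hh, rfl⟩
      exact hexp h hh
    exact this
  have hB : B.topologicalClosure = ⊤ := by
    refine ContinuousMap.subalgebra_topologicalClosure_eq_top_of_separatesPoints B fun x y hxy => ?_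
    obtain ⟨h, hh, hne⟩ := hA x y hxy
    refine ⟨_, ⟨NormedSpace.exp h, Algebra.subset_adjoin ⟨h, hh, rfl⟩, rfl⟩, ?_⟩
    simpa [ContinuousMap.exp_apply'] using hne
  refine eq_top_iff.2 fun g _ => ?_
  have hg : g ∈ B.topologicalClosure := hB ▸ Algebra.mem_top
  exact closure_minimal hBV hV hg

/-- A continuous function that factors through the features `φ i` is uniformly approximated by
networks with one hidden layer in finitely many of these features. -/
theorem exists_network_approx {ι : Type*} {σ : C(ℝ, ℝ)}
    (hσp : ¬ ∃ p : Polynomial ℝ, ∀ t, σ t = p.eval t) (φ : ι → C(X, ℝ)) (f : C(X, ℝ))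
    (hf : ∀ x y, (∀ i, φ i x = φ i y) → f x = f y) {ε : ℝ} (hε : 0 < ε) :
    ∃ (s : Finset ι) (n : ℕ) (W : Fin n → ι → ℝ) (b a : Fin n → ℝ),
      ∀ x, |f x - ∑ j, a j * σ (∑ i ∈ s, W j i * φ i x + b j)| < ε := by
  classical
  -- The features need not separate points of `X`, but the coordinates separate points of the image
  -- of `q`. As `X` is compact and the image Hausdorff, `q'` is a quotient map and `f` descends.
  let q (x : X) : ι → ℝ := fun i => φ i x
  have hq : Continuous q := continuous_pi fun i => (φ i).continuous
  let q' : X → Set.range q := Set.rangeFactorization q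
  have hq' : Continuous q' := hq.subtype_mk _
  have : CompactSpace (Set.range q) := isCompact_iff_compactSpace.1 (isCompact_range hq)
  have hquot : Topology.IsQuotientMap q' :=
    hq'.isClosedMap.isQuotientMap hq' Set.rangeFactorization_surjective
  let φ' (i : ι) : C(Set.range q, ℝ) :=
    ⟨fun y => y.1 i, (continuous_apply i).comp continuous_subtype_val⟩
  have hfac : Function.FactorsThrough f (⟨q', hq'⟩ : C(X, Set.range q)) := fun x y h =>
    hf x y fun i => congrFun (congrArg Subtype.val h) i
  let f' : C(Set.range q, ℝ) := hquot.lift (f := ⟨q', hq'⟩) f hfac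
  have hf' (x : X) : f' (q' x) = f x :=
    DFunLike.congr_fun (hquot.lift_comp (f := ⟨q', hq'⟩) f hfac) x
  let A : Submodule ℝ C(Set.range q, ℝ) := Submodule.span ℝ (insert 1 (Set.range φ'))
  have htop := topologicalClosure_span_comp_eq_top hσp A
    (Submodule.subset_span (Set.mem_insert _ _)) fun x y hxy => by
      obtain ⟨i, hi⟩ := Function.ne_iff.1 (Subtype.coe_ne_coe.2 hxy)
      exact ⟨φ' i, Submodule.subset_span (Set.mem_insert_of_mem _ ⟨i, rfl⟩), hi⟩
  have hfc : f' ∈ closure (Submodule.span ℝ ((fun h : C(Set.range q, ℝ) => σ.comp h) '' A) :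
      Set C(Set.range q, ℝ)) := by
    rw [← Submodule.topologicalClosure_coe, htop]
    trivial
  obtain ⟨g, hg, hdist⟩ := Metric.mem_closure_iff.1 hfc ε hε
  obtain ⟨n, a, G, rfl⟩ := Submodule.mem_span_set'.1 hg
  have hG (j : Fin n) : ∃ (b : ℝ) (w : ι →₀ ℝ), ∀ x,
      (G j : C(Set.range q, ℝ)) (q' x) = σ (w.sum (fun i c => c * φ i x) + b) := by
    obtain ⟨h, hh, hhG⟩ := (G j).2
    obtain ⟨b, z, hz, rfl⟩ := Submodule.mem_span_insert.1 hh
    obtain ⟨w, rfl⟩ := (Finsupp.mem_span_range_iff_exists_finsupp).1 hz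
    refine ⟨b, w, fun x => ?_⟩
    rw [← hhG]
    simp only [ContinuousMap.comp_apply, ContinuousMap.add_apply, Finsupp.sum,
      ContinuousMap.sum_apply]
    simp [add_comm, φ', q', q, Set.rangeFactorization]
  choose b w hbw using hG
  refine ⟨Finset.univ.biUnion fun j => (w j).support, n, fun j i => w j i, b, a, fun x => ?_⟩
  have h1 : dist (f' (q' x)) ((∑ j, a j • (G j : C(Set.range q, ℝ))) (q' x)) < ε :=
    (ContinuousMap.dist_apply_le_dist _).trans_lt hdist
  rw [hf', Real.dist_eq, ContinuousMap.sum_apply] at h1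
  convert h1 using 5 with j
  rw [ContinuousMap.smul_apply, hbw, smul_eq_mul, Finsupp.sum_of_support_subset _
    (Finset.subset_biUnion_of_mem (fun j => (w j).support) (Finset.mem_univ j)) _ (by simp)]

end Ridge

/-! ### Integration by parts for Stieltjes integrals -/

section IntegrationByParts

variable {T : ℝ}

theorem measurableSet_coe_lt (r : ℝ) : MeasurableSet {s : Set.Icc (0 : ℝ) T | (s : ℝ) < r} :=
  measurableSet_lt measurable_subtype_coe measurable_const

/-- Integration by parts against a finite measure on `[0, T]`. -/
theorem setIntegral_Iic_eq_sub (μ : Measure (Set.Icc (0 : ℝ) T)) [IsFiniteMeasure μ] {p p' : ℝ → ℝ}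
    (hp : ∀ s, HasDerivAt p (p' s) s) (hp' : Continuous p') (t : Set.Icc (0 : ℝ) T) :
    ∫ s in Set.Iic t, p s ∂μ = p t * μ.real (Set.Iic t) -
      ∫ r in (0 : ℝ)..t, p' r * μ.real {s | (s : ℝ) < r} := by
  -- Writing `p s = p t - ∫ r in s..t, p' r`, Fubini is applied on the region `s < r`.
  let S : Set (ℝ × Set.Icc (0 : ℝ) T) := {z | (z.2 : ℝ) < z.1}
  have hS : MeasurableSet S :=
    measurableSet_lt (measurable_subtype_coe.comp measurable_snd) measurable_fst
  let F (r : ℝ) (s : Set.Icc (0 : ℝ) T) : ℝ := S.indicator (fun z => p' z.1) (r, s)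
  have hFi : Integrable (Function.uncurry F)
      ((volume.restrict (Set.uIoc 0 (t : ℝ))).prod (μ.restrict (Set.Iic t))) := by
    have h1 : IntegrableOn p' (Set.uIoc 0 (t : ℝ)) :=
      intervalIntegrable_iff.1 (hp'.intervalIntegrable _ _)
    exact (Integrable.comp_fst h1 (μ.restrict (Set.Iic t))).indicator hS
  have h1 (s : Set.Icc (0 : ℝ) T) (hs : s ∈ Set.Iic t) : p s = p t - ∫ r in (0 : ℝ)..t, F r s := by
    have hst : (s : ℝ) ≤ t := hs
    have h2 : ∫ r in (s : ℝ)..t, p' r = p t - p s :=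
      intervalIntegral.integral_eq_sub_of_hasDerivAt (fun r _ => hp r) (hp'.intervalIntegrable _ _)
    have h3 : ∫ r in (0 : ℝ)..t, F r s = ∫ r in (s : ℝ)..t, p' r := by
      rw [intervalIntegral.integral_of_le t.2.1, intervalIntegral.integral_of_le hst]
      have : (fun r => F r s) = (Set.Ioi (s : ℝ)).indicator p' := by
        ext r; simp [F, S, Set.indicator]
      rw [this, setIntegral_indicator measurableSet_Ioi, Set.Ioc_inter_Ioi, max_eq_right s.2.1]
    rw [h3, h2]; ring
  have hpi : Integrable (fun s : Set.Icc (0 : ℝ) T => ∫ r in (0 : ℝ)..t, F r s)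
      (μ.restrict (Set.Iic t)) := by
    simp_rw [intervalIntegral.integral_of_le t.2.1, ← Set.uIoc_of_le t.2.1]
    exact hFi.integral_prod_right
  rw [setIntegral_congr_fun measurableSet_Iic h1, integral_sub (integrable_const _) hpi,
    ← intervalIntegral_integral_swap hFi, setIntegral_const, smul_eq_mul, mul_comm]
  congr 1
  refine intervalIntegral.integral_congr_ae (Filter.Eventually.of_forall fun r hr => ?_)
  rw [Set.uIoc_of_le t.2.1] at hr
  have : F r = {s : Set.Icc (0 : ℝ) T | (s : ℝ) < r}.indicator fun _ => p' r := by
    ext s; simp [F, S, Set.indicator]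
  rw [this, setIntegral_indicator (measurableSet_coe_lt r), setIntegral_const, smul_eq_mul, mul_comm]
  congr 2
  ext s
  simp only [Set.mem_inter_iff, Set.mem_Iic, Set.mem_ofPred_eq, and_iff_right_iff_imp]
  exact fun h => Subtype.coe_le_coe.1 (h.le.trans hr.2)

theorem intervalIntegrable_mul_measureReal_lt (μ : Measure (Set.Icc (0 : ℝ) T)) [IsFiniteMeasure μ]
    {g : ℝ → ℝ} (hg : Continuous g) (a b : ℝ) :
    IntervalIntegrable (fun r => g r * μ.real {s | (s : ℝ) < r}) volume a b := by
  have : Monotone fun r => μ.real {s : Set.Icc (0 : ℝ) T | (s : ℝ) < r} :=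
    fun r r' h => measureReal_mono fun s hs => lt_of_lt_of_le hs h
  exact this.intervalIntegrable.continuousOn_mul hg.continuousOn

/-- Integration by parts against a signed measure on `[0, T]`. -/
theorem signedMeasure_setIntegral_Iic_eq_sub (μ : SignedMeasure (Set.Icc (0 : ℝ) T)) {p p' : ℝ → ℝ}
    (hp : ∀ s, HasDerivAt p (p' s) s) (hp' : Continuous p') (t : Set.Icc (0 : ℝ) T) :
    ∫ᵛ s in Set.Iic t, p s ∂•μ = p t * μ (Set.Iic t) -
      ∫ r in (0 : ℝ)..t, p' r * μ {s | (s : ℝ) < r} := by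
  have hpc : Continuous p := continuous_iff_continuousAt.2 fun s => (hp s).continuousAt
  set j := μ.toJordanDecomposition
  have hμ : μ = j.posPart.toSignedMeasure - j.negPart.toSignedMeasure :=
    (SignedMeasure.toSignedMeasure_toJordanDecomposition μ).symm
  have happ (s : Set (Set.Icc (0 : ℝ) T)) (hs : MeasurableSet s) :
      μ s = j.posPart.real s - j.negPart.real s := by
    rw [hμ, sub_apply, Measure.toSignedMeasure_apply_measurable hs,
      Measure.toSignedMeasure_apply_measurable hs]
  have hint (ν : Measure (Set.Icc (0 : ℝ) T)) [IsFiniteMeasure ν] :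
      VectorMeasure.Integrable (ν.toSignedMeasure.restrict (Set.Iic t)) fun s => p s := by
    refine VectorMeasure.Integrable.restrict ?_
    rw [VectorMeasure.Integrable, Measure.variation_toSignedMeasure]
    exact (hpc.comp continuous_subtype_val).integrable_of_hasCompactSupport
      (HasCompactSupport.of_compactSpace _)
  -- Real multiplication commutes, so the bilinear pairing may be flipped to the form for positive
  -- measures.
  have hflip : ContinuousLinearMap.lsmul ℝ ℝ (E := ℝ) = (ContinuousLinearMap.lsmul ℝ ℝ).flip := by
    ext; simp
  have hval (ν : Measure (Set.Icc (0 : ℝ) T)) [IsFiniteMeasure ν] :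
      ∫ᵛ s in Set.Iic t, p s ∂•ν.toSignedMeasure = ∫ s in Set.Iic t, p s ∂ν := by
    rw [hflip, VectorMeasure.setIntegral_toSignedMeasure measurableSet_Iic]
  have hsub : ∫ᵛ s in Set.Iic t, p s ∂•μ =
      ∫ s in Set.Iic t, p s ∂j.posPart - ∫ s in Set.Iic t, p s ∂j.negPart := by
    rw [← hval, ← hval, ← VectorMeasure.integral_sub_vectorMeasure (hint _) (hint _), hμ]
    congr 1
    ext s hs
    simp [VectorMeasure.restrict_apply, hs]
  rw [hsub, setIntegral_Iic_eq_sub _ hp hp', setIntegral_Iic_eq_sub _ hp hp',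
    happ _ measurableSet_Iic]
  simp_rw [happ _ (measurableSet_coe_lt _), mul_sub]
  rw [intervalIntegral.integral_sub (intervalIntegrable_mul_measureReal_lt _ hp' _ _)
    (intervalIntegrable_mul_measureReal_lt _ hp' _ _)]
  ring

end IntegrationByParts

/-! ### Moments and signature coordinates -/

/-- A continuous function on `[0, T]` orthogonal to all monomials vanishes. -/
theorem eq_zero_of_forall_integral_pow_mul_eq_zero {T : ℝ} (hT : 0 < T) {D : ℝ → ℝ}
    (hD : Continuous D) (h : ∀ k : ℕ, ∫ r in (0 : ℝ)..T, r ^ k * D r = 0) {t : ℝ}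
    (ht : t ∈ Set.Icc 0 T) : D t = 0 := by
  have hpoly (q : Polynomial ℝ) : ∫ r in (0 : ℝ)..T, q.eval r * D r = 0 := by
    simp_rw [Polynomial.eval_eq_sum_range, Finset.sum_mul]
    rw [intervalIntegral.integral_finsetSum fun i _ =>
      Continuous.intervalIntegrable (by fun_prop) _ _]
    refine Finset.sum_eq_zero fun i _ => ?_
    simp_rw [mul_assoc]
    rw [intervalIntegral.integral_const_mul, h, mul_zero]
  have hle : ∫ r in (0 : ℝ)..T, D r * D r ≤ 0 := by
    refine le_of_forall_pos_le_add fun ε hε => ?_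
    set C := ∫ r in (0 : ℝ)..T, |D r| with hC
    have hC0 : 0 ≤ C := intervalIntegral.integral_nonneg hT.le fun _ _ => abs_nonneg _
    -- The `+ 1` covers `C = 0`. As `D` is orthogonal to `q`, its square integrates to at most `C *
    -- ε / (C + 1)`.
    have hδ : 0 < ε / (C + 1) := by positivity
    obtain ⟨q, hq⟩ := exists_polynomial_near_of_continuousOn 0 T D hD.continuousOn _ hδ
    calc ∫ r in (0 : ℝ)..T, D r * D r
        = ∫ r in (0 : ℝ)..T, (D r - q.eval r) * D r := by
          simp_rw [sub_mul]
          rw [intervalIntegral.integral_sub ((hD.fun_mul hD).intervalIntegrable _ _)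
            ((q.continuous.fun_mul hD).intervalIntegrable _ _), hpoly, sub_zero]
      _ ≤ ∫ r in (0 : ℝ)..T, ε / (C + 1) * |D r| := by
          refine intervalIntegral.integral_mono_on hT.le
            (((hD.sub q.continuous).mul hD).intervalIntegrable _ _)
            ((continuous_const.mul hD.abs).intervalIntegrable _ _) fun r hr => ?_
          refine (le_abs_self _).trans ?_
          rw [abs_mul]
          refine mul_le_mul_of_nonneg_right ?_ (abs_nonneg _)
          rw [abs_sub_comm]
          exact (hq r hr).le
      _ = ε * (C / (C + 1)) := by
          rw [intervalIntegral.integral_const_mul, ← hC]; ring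
      _ ≤ 0 + ε := by
          rw [zero_add]
          exact mul_le_of_le_one_right hε.le ((div_le_one (by positivity)).2 (by linarith))
  by_contra hne
  exact hle.not_gt (intervalIntegral.integral_pos hT (hD.mul hD).continuousOn
    (fun _ _ => mul_self_nonneg _) ⟨t, ht, mul_self_pos.2 hne⟩)

namespace BVPath

variable {T : ℝ} {d : ℕ}

theorem continuous_coord (x : BVPath T d) (l : Fin d) : Continuous fun t => x t l :=
  (EuclideanSpace.proj (𝕜 := ℝ) l).continuous.comp x.toCont.continuous

theorem limUnder_atBot_coord (hT : 0 ≤ T) (x : BVPath T d) (l : Fin d) :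
    Filter.limUnder Filter.atBot (fun t => x t l) = x ⟨0, le_rfl, hT⟩ l := by
  have hbot : IsBot (⟨0, le_rfl, hT⟩ : Set.Icc (0 : ℝ) T) := fun s => s.2.1
  have : Nonempty (Set.Icc (0 : ℝ) T) := ⟨⟨0, le_rfl, hT⟩⟩
  refine Filter.Tendsto.limUnder_eq (tendsto_const_nhds.congr' ?_)
  filter_upwards [Filter.eventually_le_atBot (⟨0, le_rfl, hT⟩ : Set.Icc (0 : ℝ) T)] with s hs
  rw [le_antisymm hs (hbot s)]

theorem stieltjes_Iic (hT : 0 ≤ T) (x : BVPath T d) (l : Fin d) (t : Set.Icc (0 : ℝ) T) :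
    x.stieltjes l (Set.Iic t) = x t l - x ⟨0, le_rfl, hT⟩ l := by
  rw [stieltjes, BoundedVariationOn.vectorMeasure_Iic, limUnder_atBot_coord hT,
    (x.continuous_coord l).continuousWithinAt.rightLim_eq]

/-- Continuity excludes atoms, so this mass equals that of `Set.Iic t`; integration by parts
produces both kinds of intervals. -/
theorem stieltjes_Iio (hT : 0 ≤ T) (x : BVPath T d) (l : Fin d) (t : Set.Icc (0 : ℝ) T) :
    x.stieltjes l (Set.Iio t) = x t l - x ⟨0, le_rfl, hT⟩ l := by
  rw [stieltjes, BoundedVariationOn.vectorMeasure_Iio, limUnder_atBot_coord hT,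
    (x.continuous_coord l).continuousWithinAt.leftLim_eq]

/-- The `l`-th coordinate of the increment of a path from time `0`, extended to real times. -/
def increment (hT : 0 ≤ T) (x : BVPath T d) (l : Fin d) (r : ℝ) : ℝ :=
  x (Set.projIcc 0 T hT r) l - x ⟨0, le_rfl, hT⟩ l

theorem continuous_increment (hT : 0 ≤ T) (x : BVPath T d) (l : Fin d) :
    Continuous (x.increment hT l) :=
  ((x.continuous_coord l).comp continuous_projIcc).sub continuous_const

theorem increment_coe (hT : 0 ≤ T) (x : BVPath T d) (l : Fin d) (t : Set.Icc (0 : ℝ) T) :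
    x.increment hT l t = x t l - x ⟨0, le_rfl, hT⟩ l := by
  rw [increment, Set.projIcc_val]

/-- Integration by parts for Stieltjes integrals along a path. -/
theorem setIntegral_stieltjes (hT : 0 ≤ T) (x : BVPath T d) (l : Fin d) {p p' : ℝ → ℝ}
    (hp : ∀ s, HasDerivAt p (p' s) s) (hp' : Continuous p') (t : Set.Icc (0 : ℝ) T) :
    ∫ᵛ s in Set.Iic t, p s ∂•(x.stieltjes l) = p t * x.increment hT l t -
      ∫ r in (0 : ℝ)..t, p' r * x.increment hT l r := by
  rw [signedMeasure_setIntegral_Iic_eq_sub _ hp hp', stieltjes_Iic hT, increment_coe]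
  congr 1
  refine intervalIntegral.integral_congr_ae (Filter.Eventually.of_forall fun r hr => ?_)
  rw [Set.uIoc_of_le t.2.1] at hr
  have hr' : r ∈ Set.Icc 0 T := ⟨hr.1.le, hr.2.trans t.2.2⟩
  have : {s : Set.Icc (0 : ℝ) T | (s : ℝ) < r} = Set.Iio ⟨r, hr'⟩ := rfl
  rw [this, stieltjes_Iio hT, ← increment_coe]

/-- The truncated exponent `k - 1` is harmless at `k = 0`, where the factor `k` vanishes. -/
theorem hasDerivAt_pow_div_factorial (k : ℕ) (s : ℝ) :
    HasDerivAt (fun s : ℝ => s ^ k / k.factorial) (k * s ^ (k - 1) / k.factorial) s :=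
  (hasDerivAt_pow k s).div_const _

/-- The iterated integrals of the time coordinate. -/
theorem iterInt_time (hT : 0 ≤ T) (x : BVPath T (d + 1)) (hx : ∀ t, x t 0 = t) (k : ℕ)
    (t : Set.Icc (0 : ℝ) T) : x.iterInt k (fun _ => 0) t = (t : ℝ) ^ k / k.factorial := by
  induction k generalizing t with
  | zero => simp [iterInt]
  | succ k ih =>
    have h1 : Fin.init (fun _ : Fin (k + 1) => (0 : Fin (d + 1))) = fun _ => 0 := rfl
    have hinc (r : ℝ) (hr : r ∈ Set.uIcc 0 (t : ℝ)) : x.increment hT 0 r = r := by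
      rw [Set.uIcc_of_le t.2.1] at hr
      have := x.increment_coe hT 0 ⟨r, hr.1, hr.2.trans t.2.2⟩
      simpa [hx] using this
    rw [iterInt, h1, funext ih,
      setIntegral_stieltjes hT x 0 (hasDerivAt_pow_div_factorial k) (by fun_prop),
      hinc t Set.right_mem_uIcc, intervalIntegral.integral_congr
        (g := fun r => (k : ℝ) / k.factorial * r ^ k) fun r hr => by
          simp only [hinc r hr]
          rcases k with - | k
          · simp
          · rw [Nat.add_sub_cancel]; ring]
    rw [intervalIntegral.integral_const_mul, integral_pow, Nat.factorial_succ]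
    push_cast
    field_simp
    ring

/-- The iterated integral of the word `0 ⋯ 0 l`, where `0` is the time coordinate. -/
theorem iterInt_snoc_time (hT : 0 ≤ T) (x : BVPath T (d + 1)) (hx : ∀ t, x t 0 = t) (k : ℕ)
    (l : Fin (d + 1)) (t : Set.Icc (0 : ℝ) T) :
    x.iterInt (k + 1) (Fin.snoc (α := fun _ => Fin (d + 1)) (fun _ => 0) l) t =
      (t : ℝ) ^ k / k.factorial * x.increment hT l t -
        ∫ r in (0 : ℝ)..t, k * r ^ (k - 1) / k.factorial * x.increment hT l r := by
  rw [iterInt, Fin.init_snoc, Fin.snoc_last, funext (iterInt_time hT x hx k),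
    setIntegral_stieltjes hT x l (hasDerivAt_pow_div_factorial k) (by fun_prop)]

/-- The iterated integrals of the words `0 ⋯ 0 l` determine the increments of the `l`-th
coordinate. -/
theorem increment_eq_of_iterInt_eq (hT : 0 < T) {x y : BVPath T (d + 1)} (hx : ∀ t, x t 0 = t)
    (hy : ∀ t, y t 0 = t) (l : Fin (d + 1))
    (h : ∀ k, x.iterInt (k + 1) (Fin.snoc (α := fun _ => Fin (d + 1)) (fun _ => 0) l)
        ⟨T, hT.le, le_rfl⟩ =
      y.iterInt (k + 1) (Fin.snoc (α := fun _ => Fin (d + 1)) (fun _ => 0) l)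
        ⟨T, hT.le, le_rfl⟩) (t : Set.Icc (0 : ℝ) T) :
    x.increment hT.le l t = y.increment hT.le l t := by
  simp_rw [iterInt_snoc_time hT.le x hx, iterInt_snoc_time hT.le y hy] at h
  have h0 : x.increment hT.le l T = y.increment hT.le l T := by simpa using h 0
  refine sub_eq_zero.1 (eq_zero_of_forall_integral_pow_mul_eq_zero hT
    (D := fun r => x.increment hT.le l r - y.increment hT.le l r)
    ((x.continuous_increment hT.le l).sub (y.continuous_increment hT.le l)) (fun k => ?_) t.2)
  -- Once the endpoint terms cancel, the word with `k + 1` letters `0` yields the `k`-th moment.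
  have h1 := h (k + 1)
  rw [h0, sub_right_inj, Nat.add_sub_cancel] at h1
  have h2 (z : BVPath T (d + 1)) :
      ∫ r in (0 : ℝ)..T, ((k + 1 : ℕ) : ℝ) * r ^ k / (k + 1).factorial * z.increment hT.le l r =
        (k.factorial : ℝ)⁻¹ * ∫ r in (0 : ℝ)..T, r ^ k * z.increment hT.le l r := by
    rw [← intervalIntegral.integral_const_mul]
    congr 1
    ext r
    rw [Nat.factorial_succ]
    push_cast
    field_simp
  rw [h2, h2] at h1
  have h3 := mul_left_cancel₀ (by positivity) h1
  simp_rw [mul_sub]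
  rw [intervalIntegral.integral_sub, h3, sub_self]
  · exact ((continuous_pow k).mul (x.continuous_increment hT.le l)).intervalIntegrable _ _
  · exact ((continuous_pow k).mul (y.continuous_increment hT.le l)).intervalIntegrable _ _

theorem continuous_toCont : Continuous (toCont : BVPath T d → _) := by
  refine LipschitzWith.continuous (K := 1) (LipschitzWith.of_dist_le_mul fun x y => ?_)
  have h1 : dist x y = (x - y).oneVar + ‖(x - y).toCont‖ := dist_eq_norm x y
  have h2 : dist x.toCont y.toCont = ‖(x - y).toCont‖ := dist_eq_norm _ _
  have h3 : 0 ≤ (x - y).oneVar := ENNReal.toReal_nonneg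
  rw [h1, h2, NNReal.coe_one, one_mul]
  linarith

end BVPath

/-! ### Features of the convolutional layer -/

theorem cnnLayer_apply_zero {T : ℝ} {d c : ℕ} (κ : Matrix (Fin c) (Fin c) ℝ) (x : BVPath T d)
    (i : Fin c) (t : Set.Icc (0 : ℝ) T) : cnnLayer κ x i t 0 = t := rfl

theorem cnnLayer_apply_succ {T : ℝ} {d c : ℕ} (κ : Matrix (Fin c) (Fin c) ℝ) (x : BVPath T d)
    (i : Fin c) (t : Set.Icc (0 : ℝ) T) (l : Fin (d / c)) :
    cnnLayer κ x i t l.succ = ∑ j : Fin c, κ i j * x t (blockIndex l j) := rfl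

theorem cnnLayer_one_apply_succ {T : ℝ} {d c : ℕ} (x : BVPath T d)
    (i : Fin c) (t : Set.Icc (0 : ℝ) T) (l : Fin (d / c)) :
    cnnLayer 1 x i t l.succ = x t (blockIndex l i) := by
  simp [cnnLayer_apply_succ, Matrix.one_apply]

theorem exists_blockIndex_eq {d c : ℕ} (hcd : c ∣ d) (n : Fin d) :
    ∃ (l : Fin (d / c)) (i : Fin c), blockIndex l i = n := by
  -- If `c = 0`, then `d = 0` and there is no `n`.
  have hc : 0 < c := by
    rcases Nat.eq_zero_or_pos c with rfl | h
    · exact absurd n.2 (by simp [Nat.eq_zero_of_zero_dvd hcd])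
    · exact h
  refine ⟨⟨n / c, Nat.div_lt_div_of_lt_of_dvd hcd n.2⟩, ⟨n % c, Nat.mod_lt _ hc⟩, Fin.ext ?_⟩
  exact Nat.div_add_mod' n c

/-- The signature coordinate of the word `0 ⋯ 0 l`, with `k` letters `0`, of the `i`-th output path
of the convolutional layer with the identity matrix. -/
def timeMoment {T : ℝ} (hT : 0 ≤ T) {d c : ℕ} (p : Fin c × Fin (d / c) × ℕ) (x : BVPath T d) : ℝ :=
  (cnnLayer 1 x p.1).iterInt (p.2.2 + 1)
    (Fin.snoc (α := fun _ => Fin (d / c + 1)) (fun _ => 0) p.2.1.succ) ⟨T, hT, le_rfl⟩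

/-- After integration by parts only values of the path occur, so continuity in the supremum norm
suffices, which the path norm dominates. -/
theorem continuous_timeMoment {T : ℝ} (hT : 0 ≤ T) {d c : ℕ} (p : Fin c × Fin (d / c) × ℕ) :
    Continuous (timeMoment hT p : BVPath T d → ℝ) := by
  obtain ⟨i, l, k⟩ := p
  have heval : Continuous fun z : BVPath T d × Set.Icc (0 : ℝ) T => z.1.toCont z.2 :=
    continuous_eval.comp (BVPath.continuous_toCont.prodMap continuous_id)
  have hinc : Continuous fun z : BVPath T d × ℝ => (cnnLayer 1 z.1 i).increment hT l.succ z.2 := by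
    have h (t : ℝ → Set.Icc (0 : ℝ) T) (ht : Continuous t) :
        Continuous fun z : BVPath T d × ℝ => z.1 (t z.2) (blockIndex l i) :=
      (EuclideanSpace.proj (𝕜 := ℝ) (blockIndex l i)).continuous.comp
        (heval.comp (continuous_fst.prodMk (ht.comp continuous_snd)))
    simp only [BVPath.increment, cnnLayer_one_apply_succ]
    exact (h _ continuous_projIcc).sub (h _ continuous_const)
  have heq : (timeMoment hT (i, l, k) : BVPath T d → ℝ) = fun x =>
      T ^ k / k.factorial * (cnnLayer 1 x i).increment hT l.succ T -
        ∫ r in (0 : ℝ)..T, k * r ^ (k - 1) / k.factorial *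
          (cnnLayer 1 x i).increment hT l.succ r :=
    funext fun x => BVPath.iterInt_snoc_time hT _ (cnnLayer_apply_zero 1 x i) k l.succ _
  rw [heq]
  refine (continuous_const.mul (hinc.comp (continuous_id.prodMk continuous_const))).sub ?_
  refine intervalIntegral.continuous_parametric_intervalIntegral_of_continuous' ?_ 0 T
  exact (by fun_prop : Continuous fun z : BVPath T d × ℝ =>
    (k : ℝ) * z.2 ^ (k - 1) / k.factorial).mul hinc

/-- Paths with the same time moments differ by a constant. -/
theorem exists_eq_add_of_timeMoment_eq {T : ℝ} (hT : 0 < T) {d c : ℕ} (hcd : c ∣ d)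
    {x y : BVPath T d}
    (h : ∀ p : Fin c × Fin (d / c) × ℕ, timeMoment hT.le p x = timeMoment hT.le p y) :
    ∃ v : EuclideanSpace ℝ (Fin d), ∀ t, x t = y t + v := by
  refine ⟨x ⟨0, le_rfl, hT.le⟩ - y ⟨0, le_rfl, hT.le⟩, fun t => ?_⟩
  ext n
  obtain ⟨l, i, rfl⟩ := exists_blockIndex_eq hcd n
  have := BVPath.increment_eq_of_iterInt_eq hT (cnnLayer_apply_zero 1 x i)
    (cnnLayer_apply_zero 1 y i) l.succ (fun k => h (i, l, k)) t
  rw [BVPath.increment_coe, BVPath.increment_coe] at this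
  simp only [cnnLayer_one_apply_succ] at this
  simp only [PiLp.add_apply, PiLp.sub_apply]
  linarith

/-- The position of a time moment in the truncated signatures. -/
def timeMomentIndex {d c : ℕ} (m : ℕ) (p : Fin c × Fin (d / c) × ℕ) :
    Fin c × TruncWord (d / c + 1) m :=
  (p.1, if h : p.2.2 + 1 < m + 1 then
    ⟨⟨p.2.2 + 1, h⟩, Fin.snoc (α := fun _ => Fin (d / c + 1)) (fun _ => 0) p.2.1.succ⟩
    -- The empty word is a default for words longer than `m`.
    else ⟨0, Fin.elim0⟩)

theorem cnnSig_timeMomentIndex {T : ℝ} (hT : 0 ≤ T) {d c m : ℕ} {p : Fin c × Fin (d / c) × ℕ}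
    (hp : p.2.2 < m) (x : BVPath T d) :
    cnnSig hT m 1 x (timeMomentIndex m p) = timeMoment hT p x := by
  rw [timeMomentIndex, dif_pos (Nat.succ_lt_succ hp)]
  rfl

/-! ### Assembling the network -/

/-- Networks with one hidden layer in finitely many coordinates. -/
theorem isNeuralNetwork_sum_comp {σ : ℝ → ℝ} {ι κ : Type} [Fintype κ] (s : Finset ι) (e : ι → κ)
    {n : ℕ} (W : Fin n → ι → ℝ) (b a : Fin n → ℝ) :
    IsNeuralNetwork σ fun z : κ → ℝ => ∑ j, a j * σ (∑ i ∈ s, W j i * z (e i) + b j) := by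
  classical
  -- Since `e` need not be injective, the weights are summed over its fibres.
  refine ⟨n, _, a, 0, .first (fun j p => ∑ i ∈ s with e i = p, W j i) b, fun z => ?_⟩
  rw [add_zero]
  refine Finset.sum_congr rfl fun j _ => ?_
  congr 3
  simp only [Matrix.mulVec, dotProduct]
  rw [← Finset.sum_fiberwise s e]
  refine Finset.sum_congr rfl fun p _ => ?_
  rw [Finset.sum_mul]
  refine Finset.sum_congr rfl fun i hi => ?_
  rw [(Finset.mem_filter.1 hi).2]

theorem theorem2 {T : ℝ} (hT : 0 < T) {d c : ℕ} (hcd : c ∣ d)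
    (σ : ℝ → ℝ) (hσ : Continuous σ) (hσp : ¬ ∃ p : Polynomial ℝ, ∀ t, σ t = p.eval t)
    (K : Set (PLPath T d)) (hK : IsCompact K)
    (f : PLPath T d → ℝ) (hf : ∃ L, LipschitzOnWith L f K)
    (hfK : ∀ x ∈ K, ∀ y ∈ K, (∃ v : EuclideanSpace ℝ (Fin d), ∀ t, x.1 t = y.1 t + v) → f x = f y)
    (ε : ℝ) (hε : 0 < ε) :
    ∃ (κ : Matrix (Fin c) (Fin c) ℝ) (m : ℕ)
      (Φ : (Fin c × TruncWord (d / c + 1) m → ℝ) → ℝ), IsNeuralNetwork σ Φ ∧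
      BddAbove ((fun x : PLPath T d => |f x - Φ (cnnSig hT.le m κ x.1)|) '' K) ∧
      sSup ((fun x : PLPath T d => |f x - Φ (cnnSig hT.le m κ x.1)|) '' K) < ε := by
  obtain ⟨L, hL⟩ := hf
  have : CompactSpace K := isCompact_iff_compactSpace.1 hK
  let φ (p : Fin c × Fin (d / c) × ℕ) : C(K, ℝ) :=
    ⟨fun x => timeMoment hT.le p x.1.1, (continuous_timeMoment hT.le p).comp
      (continuous_subtype_val.comp continuous_subtype_val)⟩
  -- Pointwise strict bounds give only a weak bound on the supremum, hence `ε / 2`.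
  obtain ⟨s, n, W, b, a, hW⟩ := exists_network_approx (σ := ⟨σ, hσ⟩) hσp φ
    ⟨K.domRestrict f, hL.continuousOn.domRestrict⟩ (fun x y h => hfK x x.2 y y.2
      (exists_eq_add_of_timeMoment_eq hT hcd h)) (half_pos hε)
  -- The greatest length of a word used: `p.2.2` letters `0` and one more.
  let m := s.sup fun p => p.2.2 + 1
  let Φ (z : Fin c × TruncWord (d / c + 1) m → ℝ) : ℝ :=
    ∑ j, a j * σ (∑ i ∈ s, W j i * z (timeMomentIndex m i) + b j)
  have hΦ (x : PLPath T d) (hx : x ∈ K) : |f x - Φ (cnnSig hT.le m 1 x.1)| ≤ ε / 2 := by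
    refine le_of_eq_of_le ?_ (hW ⟨x, hx⟩).le
    congr 2
    refine Finset.sum_congr rfl fun j _ => ?_
    congr 3
    refine Finset.sum_congr rfl fun p hp => ?_
    rw [cnnSig_timeMomentIndex hT.le (Finset.le_sup (f := fun p => p.2.2 + 1) hp)]
    rfl
  -- `Real.sSup_le` also covers empty `K`, as the bound is nonnegative.
  refine ⟨1, m, Φ, isNeuralNetwork_sum_comp s _ W b a, ⟨ε / 2, ?_⟩,
    (Real.sSup_le ?_ (half_pos hε).le).trans_lt (half_lt_self hε)⟩
  · rintro _ ⟨x, hx, rfl⟩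
    exact hΦ x hx
  · rintro _ ⟨x, hx, rfl⟩
    exact hΦ x hx

end
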